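/- Let $\mathcal C$ be a rigid braided monoidal category in which all idempotents split: every object has a left and a right dual, and every $e=e^2:X\to X$ can be written $e=i\circ p$ with $p\circ i=1$. Let $H$ be a Hopf algebra in $\mathcal C$ with multiplication $\mu$, unit $\eta$, comultiplication $\Delta$, counit $\varepsilon$ and invertible antipode $S$. An object $K$ of $\mathcal C$ is called invertible if $K\otimes K^{-1}\simeq\mathbf 1$ for some object $K^{-1}$. For an object $X$ of $\mathcal C$ (suppressing associativity and unit isomorphisms): - a left (resp. right) $X$-valued integral on $H$ is a morphism $f:H\to X$ with $(1_H\otimes f)\circ\Delta=\eta\otimes f$ (resp. $(f\otimes 1_H)\circ\Delta=f\otimes\eta$); - a left (resp. right) $X$-based integral in $H$ is a morphism $f:X\to H$ with $\mu\circ(1_H\otimes f)=\varepsilon\otimes f$ (resp. $\mu\circ(f\otimes 1_H)=f\otimes\varepsilon$). Then there exists an invertible object $\int H$ of $\mathcal C$ for which the following hold simultaneously. 1. There exist a left $\int H$-valued integral $\int^{\ell}:H\to\int H$ and a right $\int H$-valued integral $\int^{r}:H\to\int H$ on $H$ such that, for every object $X$, every left (resp. right) $X$-valued integral $f$ on $H$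 factors as $f=g\circ\int^{\ell}$ (resp. $f=g\circ\int^{r}$) for a unique morphism $g:\int H\to X$. 2. There exist a left $\int H$-based integral $\Lambda^{\ell}:\int H\to H$ and a right $\int H$-based integral $\Lambda^{r}:\int H\to H$ in $H$ such that, for every object $X$, every left (resp. right) $X$-based integral $f$ in $H$ factors as $f=\Lambda^{\ell}\circ h$ (resp. $f=\Lambda^{r}\circ h$) for a unique morphism $h:X\to\int H$. -/

import Mathlib

open CategoryTheory MonoidalCategory
open scoped MonObj ComonObj

namespace BraidedIntegral

universe v u

/-- An object `K` is invertible if some object `L` satisfies `K ⊗ L ≅ 𝟙`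
(in a braided category `L ⊗ K ≅ 𝟙` then follows). -/
def IsInvertibleObj {C : Type u} [Category.{v} C] [MonoidalCategory C] [BraidedCategory C]
    (K : C) : Prop :=
  ∃ L : C, Nonempty (K ⊗ L ≅ 𝟙_ C)

/-- `f : H ⟶ X` is a left `X`-valued integral on `H`: `(1_H ⊗ f) ∘ Δ = η ⊗ f`. -/
def IsLeftIntegralOn {C : Type u} [Category.{v} C] [MonoidalCategory C] [BraidedCategory C]
    {H X : C} [BimonObj H] (f : H ⟶ X) : Prop :=
  Δ[H] ≫ H ◁ f = f ≫ (λ_ X).inv ≫ η[H] ▷ X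

/-- `f : H ⟶ X` is a right `X`-valued integral on `H`: `(f ⊗ 1_H) ∘ Δ = f ⊗ η`. -/
def IsRightIntegralOn {C : Type u} [Category.{v} C] [MonoidalCategory C] [BraidedCategory C]
    {H X : C} [BimonObj H] (f : H ⟶ X) : Prop :=
  Δ[H] ≫ f ▷ H = f ≫ (ρ_ X).inv ≫ X ◁ η[H]

/-- `f : X ⟶ H` is a left `X`-based integral in `H`: `μ ∘ (1_H ⊗ f) = ε ⊗ f`. -/
def IsLeftIntegralIn {C : Type u} [Category.{v} C] [MonoidalCategory C] [BraidedCategory C]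
    {H X : C} [BimonObj H] (f : X ⟶ H) : Prop :=
  H ◁ f ≫ μ[H] = ε[H] ▷ X ≫ (λ_ X).hom ≫ f

/-- `f : X ⟶ H` is a right `X`-based integral in `H`: `μ ∘ (f ⊗ 1_H) = f ⊗ ε`. -/
def IsRightIntegralIn {C : Type u} [Category.{v} C] [MonoidalCategory C] [BraidedCategory C]
    {H X : C} [BimonObj H] (f : X ⟶ H) : Prop :=
  f ▷ H ≫ μ[H] = X ◁ ε[H] ≫ (ρ_ X).hom ≫ f

end BraidedIntegral

/-! Write P(x) = (eᵢ)₁ eⁱ(S²((eᵢ)₂) x) for `intProj H`, in Sweedler notation with dual bases; here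
and below such formulas suppress braidings. If f is a right integral on H then f ∘ P = f
(`intProj_comp_rightIntegral`), and if f is a left integral in H then P ∘ f = f
(`leftIntegral_comp_intProj`). Conversely, P is itself a right integral on H (`comul_intProj`) and,
because S is invertible, a left integral in H (`antipode_intProj_join`). Hence P is idempotent.
Splitting it as P = i ∘ p through an object I makes p the universal right integral on H and i the
universal left integral in H, with factorizations f = (f ∘ i) ∘ p and f = i ∘ (p ∘ f). Composition
with S or its inverse exchanges left and right, so the same I serves all four universal properties.

For invertibility put t = p ∘ S ∘ i. The self-braiding of I is t ⊗ 1 (`cross_self_eq_of_integrals`).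
The trace of t, closed up with one braiding, equals that of S ∘ P by cyclicity, and this is 1
(`cup_integrals_cap`). Together these make the coevaluation of I an isomorphism
(`isInvertibleObj_of_cross`).

Calculations take place on right-bracketed words with a passive tail Z. Every operation acts at the
head of a subword, so associators disappear and operations on disjoint letters commute by
naturality. -/

namespace BraidedIntegral

/-! ### Graphical calculus on right-bracketed words -/

section Words

universe v u

variable {C : Type u} [Category.{v} C] [MonoidalCategory C]

/-- A morphism `A ⊗ B ⟶ D` acting on the first two letters of a right-bracketed word. -/
def join {A B D : C} (f : A ⊗ B ⟶ D) (Z : C) : A ⊗ (B ⊗ Z) ⟶ D ⊗ Z := (α_ A B Z).inv ≫ f ▷ Z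

/-- A morphism `A ⟶ B ⊗ D` acting on the first letter of a right-bracketed word. -/
def split {A B D : C} (f : A ⟶ B ⊗ D) (Z : C) : A ⊗ Z ⟶ B ⊗ (D ⊗ Z) := f ▷ Z ≫ (α_ B D Z).hom

/-- A morphism `𝟙_ C ⟶ A` inserting a letter at the start of a word. -/
def ins {A : C} (f : 𝟙_ C ⟶ A) (Z : C) : Z ⟶ A ⊗ Z := (λ_ Z).inv ≫ f ▷ Z

/-- A morphism `A ⟶ 𝟙_ C` deleting the first letter of a word. -/
def del {A : C} (f : A ⟶ 𝟙_ C) (Z : C) : A ⊗ Z ⟶ Z := f ▷ Z ≫ (λ_ Z).hom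

/-- A morphism `𝟙_ C ⟶ A ⊗ B` inserting two letters at the start of a word. -/
def cup {A B : C} (f : 𝟙_ C ⟶ A ⊗ B) (Z : C) : Z ⟶ A ⊗ (B ⊗ Z) :=
  (λ_ Z).inv ≫ f ▷ Z ≫ (α_ A B Z).hom

/-- A morphism `A ⊗ B ⟶ 𝟙_ C` deleting the first two letters of a word. -/
def cap {A B : C} (f : A ⊗ B ⟶ 𝟙_ C) (Z : C) : A ⊗ (B ⊗ Z) ⟶ Z :=
  (α_ A B Z).inv ≫ f ▷ Z ≫ (λ_ Z).hom

variable {A B D Z Z' : C}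

lemma join_nat (f : A ⊗ B ⟶ D) (g : Z ⟶ Z') : join f Z ≫ D ◁ g = A ◁ B ◁ g ≫ join f Z' := by
  simp only [join, Category.assoc, ← whisker_exchange]
  simp

lemma split_nat (f : A ⟶ B ⊗ D) (g : Z ⟶ Z') : split f Z ≫ B ◁ D ◁ g = A ◁ g ≫ split f Z' := by
  simp [split, whisker_exchange_assoc]

lemma ins_nat (f : 𝟙_ C ⟶ A) (g : Z ⟶ Z') : ins f Z ≫ A ◁ g = g ≫ ins f Z' := by
  simp [ins, ← whisker_exchange]

lemma del_nat (f : A ⟶ 𝟙_ C) (g : Z ⟶ Z') : del f Z ≫ g = A ◁ g ≫ del f Z' := by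
  simp [del, whisker_exchange_assoc]

lemma cup_nat (f : 𝟙_ C ⟶ A ⊗ B) (g : Z ⟶ Z') : cup f Z ≫ A ◁ B ◁ g = g ≫ cup f Z' := by
  simp only [cup, Category.assoc, ← associator_naturality_right, ← whisker_exchange_assoc]
  simp

lemma cap_nat (f : A ⊗ B ⟶ 𝟙_ C) (g : Z ⟶ Z') : cap f Z ≫ g = A ◁ B ◁ g ≫ cap f Z' := by
  simp only [cap, Category.assoc, ← leftUnitor_naturality, ← whisker_exchange_assoc]
  simp

variable [BraidedCategory C]

/-- The braiding of the first two letters of a right-bracketed word. -/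
def cross (A B Z : C) : A ⊗ (B ⊗ Z) ⟶ B ⊗ (A ⊗ Z) :=
  (α_ A B Z).inv ≫ (β_ A B).hom ▷ Z ≫ (α_ B A Z).hom

lemma cross_nat (g : Z ⟶ Z') : cross A B Z ≫ B ◁ A ◁ g = A ◁ B ◁ g ≫ cross A B Z' := by
  simp only [cross, Category.assoc, ← associator_naturality_right, ← whisker_exchange_assoc]
  simp

lemma cross_nat_left {A' : C} (f : A ⟶ A') (B Z : C) :
    f ▷ (B ⊗ Z) ≫ cross A' B Z = cross A B Z ≫ B ◁ f ▷ Z := by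
  simp only [cross, Category.assoc, associator_inv_naturality_left_assoc,
    ← comp_whiskerRight_assoc, BraidedCategory.braiding_naturality_left]
  simp

lemma cross_nat_right (A : C) {B' : C} (f : B ⟶ B') (Z : C) :
    A ◁ f ▷ Z ≫ cross A B' Z = cross A B Z ≫ f ▷ (A ⊗ Z) := by
  simp only [cross, Category.assoc, associator_inv_naturality_middle_assoc,
    ← comp_whiskerRight_assoc, BraidedCategory.braiding_naturality_right]
  simp

lemma cross_tensor_left (A B D Z : C) :
    cross (A ⊗ B) D Z = (α_ A B (D ⊗ Z)).hom ≫ A ◁ cross B D Z ≫ cross A D (B ⊗ Z) ≫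
      D ◁ (α_ A B Z).inv := by
  simp only [cross, BraidedCategory.braiding_tensor_left_hom]
  monoidal

lemma cross_tensor_right (A B D Z : C) :
    cross A (B ⊗ D) Z = A ◁ (α_ B D Z).hom ≫ cross A B (D ⊗ Z) ≫ B ◁ cross A D Z ≫
      (α_ B D (A ⊗ Z)).inv := by
  simp only [cross, BraidedCategory.braiding_tensor_right_hom]
  monoidal

lemma cross_unit_left (A Z : C) : cross (𝟙_ C) A Z = (λ_ (A ⊗ Z)).hom ≫ A ◁ (λ_ Z).inv := by
  simp only [cross, braiding_tensorUnit_left]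
  monoidal

lemma cross_unit_right (A Z : C) : cross A (𝟙_ C) Z = A ◁ (λ_ Z).hom ≫ (λ_ (A ⊗ Z)).inv := by
  simp only [cross, braiding_tensorUnit_right]
  monoidal

lemma cross_join (A : C) {X Y : C} (f : X ⊗ Y ⟶ B) (Z : C) :
    A ◁ join f Z ≫ cross A B Z = cross A X (Y ⊗ Z) ≫ X ◁ cross A Y Z ≫ join f (A ⊗ Z) := by
  simp only [join, whiskerLeft_comp, Category.assoc, cross_nat_right, cross_tensor_right]
  simp

lemma join_cross {X Y : C} (f : X ⊗ Y ⟶ B) (A Z : C) :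
    join f (A ⊗ Z) ≫ cross B A Z = X ◁ cross Y A Z ≫ cross X A (Y ⊗ Z) ≫ A ◁ join f Z := by
  simp only [join, whiskerLeft_comp, Category.assoc, cross_nat_left, cross_tensor_left]
  simp

lemma cross_split (A : C) {X Y : C} (f : B ⟶ X ⊗ Y) (Z : C) :
    A ◁ split f Z ≫ cross A X (Y ⊗ Z) ≫ X ◁ cross A Y Z = cross A B Z ≫ split f (A ⊗ Z) := by
  simp only [split, whiskerLeft_comp, Category.assoc, ← reassoc_of% @cross_nat_right,
    cross_tensor_right]
  simp

lemma split_cross {X Y : C} (f : B ⟶ X ⊗ Y) (A Z : C) :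
    split f (A ⊗ Z) ≫ X ◁ cross Y A Z ≫ cross X A (Y ⊗ Z) = cross B A Z ≫ A ◁ split f Z := by
  simp only [split, whiskerLeft_comp, Category.assoc, ← reassoc_of% @cross_nat_left,
    cross_tensor_left]
  simp

lemma cross_ins (A : C) (f : 𝟙_ C ⟶ B) (Z : C) :
    A ◁ ins f Z ≫ cross A B Z = ins f (A ⊗ Z) := by
  simp [ins, cross_nat_right, cross_unit_right]

lemma ins_cross (f : 𝟙_ C ⟶ B) (A Z : C) :
    ins f (A ⊗ Z) ≫ cross B A Z = A ◁ ins f Z := by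
  simp only [ins, Category.assoc, cross_nat_left, cross_unit_left]
  simp

lemma cross_del (A : C) (f : B ⟶ 𝟙_ C) (Z : C) :
    cross A B Z ≫ del f (A ⊗ Z) = A ◁ del f Z := by
  simp only [del, ← reassoc_of% @cross_nat_right, cross_unit_right]
  simp

lemma del_cross (f : B ⟶ 𝟙_ C) (A Z : C) :
    cross B A Z ≫ A ◁ del f Z = del f (A ⊗ Z) := by
  simp [del, ← reassoc_of% @cross_nat_left, cross_unit_left]

lemma cross_cup (A : C) {X Y : C} (f : 𝟙_ C ⟶ X ⊗ Y) (Z : C) :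
    A ◁ cup f Z ≫ cross A X (Y ⊗ Z) ≫ X ◁ cross A Y Z = cup f (A ⊗ Z) := by
  have := cross_ins A f Z
  simp only [ins, whiskerLeft_comp, cross_tensor_right, Category.assoc] at this
  simpa [cup] using this =≫ (α_ _ _ _).hom

lemma cross_cap (A : C) {X Y : C} (f : X ⊗ Y ⟶ 𝟙_ C) (Z : C) :
    cross A X (Y ⊗ Z) ≫ X ◁ cross A Y Z ≫ cap f (A ⊗ Z) = A ◁ cap f Z := by
  have := A ◁ (α_ _ _ _).inv ≫= cross_del A f Z
  simpa [cap, del, cross_tensor_right] using this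

/-- The crossing of A and B is a `join` into B ⊗ A, so this is naturality of the braiding with D,
unfolded by the hexagon. -/
lemma cross_yang_baxter (A B D Z : C) :
    cross A B (D ⊗ Z) ≫ B ◁ cross A D Z ≫ cross B D (A ⊗ Z) =
      A ◁ cross B D Z ≫ cross A D (B ⊗ Z) ≫ D ◁ cross A B Z := by
  have key : join (β_ A B).hom (D ⊗ Z) ≫ cross (B ⊗ A) D Z
      = A ◁ cross B D Z ≫ cross A D (B ⊗ Z) ≫ D ◁ join (β_ A B).hom Z := join_cross _ _ _
  simp only [cross_tensor_left, join] at key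
  have := key =≫ D ◁ (α_ _ _ _).hom
  simpa [cross] using this

end Words

/-! ### Zigzag identities and Hopf algebra axioms on words -/

section Hopf

open HopfObj

universe v u

variable {C : Type u} [Category.{v} C] [MonoidalCategory C]

section Dual

variable (X : C) [HasRightDual X] (Z : C)

lemma cup_cap : cup (η_ X Xᘁ) (X ⊗ Z) ≫ X ◁ cap (ε_ X Xᘁ) Z = 𝟙 _ := by
  have := congr($(ExactPairing.evaluation_coevaluation X Xᘁ) ▷ Z)
  calc
    _ = (λ_ _).inv ≫ (α_ _ _ _).inv ≫ ((η_ X Xᘁ ▷ X ≫ (α_ _ _ _).hom ≫ X ◁ ε_ X Xᘁ) ▷ Z) ≫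
        (α_ _ _ _).hom ≫ X ◁ (λ_ _).hom := by
      simp only [cup, cap]
      monoidal
    _ = _ := by
      rw [this]
      monoidal

lemma cap_cup : Xᘁ ◁ cup (η_ X Xᘁ) Z ≫ cap (ε_ X Xᘁ) (Xᘁ ⊗ Z) = 𝟙 _ := by
  have := congr($(ExactPairing.coevaluation_evaluation X Xᘁ) ▷ Z)
  calc
    _ = Xᘁ ◁ (λ_ _).inv ≫ (α_ _ _ _).inv ≫
        ((Xᘁ ◁ η_ X Xᘁ ≫ (α_ _ _ _).inv ≫ ε_ X Xᘁ ▷ Xᘁ) ▷ Z) ≫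
        (α_ _ _ _).hom ≫ (λ_ _).hom := by
      simp only [cup, cap]
      monoidal
    _ = _ := by
      rw [this]
      monoidal

end Dual

variable [BraidedCategory C] (H : C) (Z : C)

section Bialgebra

variable [BimonObj H]

lemma join_mul_assoc :
    H ◁ join μ[H] Z ≫ join μ[H] Z = join μ[H] (H ⊗ Z) ≫ join μ[H] Z := by
  have := congr($(MonObj.mul_assoc H) ▷ Z)
  calc
    _ = H ◁ (α_ _ _ _).inv ≫ (α_ _ _ _).inv ≫ (α_ _ _ _).inv ▷ Z ≫
        (((α_ _ _ _).hom ≫ H ◁ μ[H] ≫ μ[H]) ▷ Z) := by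
      simp only [join]
      monoidal
    _ = _ := by
      rw [← this]
      simp only [join]
      monoidal

lemma ins_one_join_mul : ins η[H] (H ⊗ Z) ≫ join μ[H] Z = 𝟙 _ := by
  have := congr($(MonObj.one_mul H) ▷ Z)
  calc
    _ = (λ_ _).inv ≫ (α_ _ _ _).inv ≫ ((η[H] ▷ H ≫ μ[H]) ▷ Z) := by
      simp only [join, ins]
      monoidal
    _ = _ := by
      rw [this]
      monoidal

lemma whiskerLeft_ins_one_join_mul : H ◁ ins η[H] Z ≫ join μ[H] Z = 𝟙 _ := by
  have := congr($(MonObj.mul_one H) ▷ Z)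
  calc
    _ = H ◁ (λ_ _).inv ≫ (α_ _ _ _).inv ≫ ((H ◁ η[H] ≫ μ[H]) ▷ Z) := by
      simp only [join, ins]
      monoidal
    _ = _ := by
      rw [this]
      monoidal

lemma split_comul_assoc :
    split Δ[H] Z ≫ H ◁ split Δ[H] Z = split Δ[H] Z ≫ split Δ[H] (H ⊗ Z) := by
  have := congr($(ComonObj.comul_assoc H) ▷ Z)
  calc
    _ = ((Δ[H] ≫ H ◁ Δ[H]) ▷ Z) ≫ (α_ _ _ _).hom ≫ H ◁ (α_ _ _ _).hom := by
      simp only [split]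
      monoidal
    _ = _ := by
      rw [this]
      simp only [split]
      monoidal

lemma split_comul_del : split Δ[H] Z ≫ del ε[H] (H ⊗ Z) = 𝟙 _ := by
  have := congr($(ComonObj.counit_comul H) ▷ Z)
  calc
    _ = ((Δ[H] ≫ ε[H] ▷ H) ▷ Z) ≫ (α_ _ _ _).hom ≫ (λ_ _).hom := by
      simp only [split, del]
      monoidal
    _ = _ := by
      rw [this]
      monoidal

lemma split_comul_whiskerLeft_del : split Δ[H] Z ≫ H ◁ del ε[H] Z = 𝟙 _ := by
  have := congr($(ComonObj.comul_counit H) ▷ Z)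
  calc
    _ = ((Δ[H] ≫ H ◁ ε[H]) ▷ Z) ≫ (α_ _ _ _).hom ≫ H ◁ (λ_ _).hom := by
      simp only [split, del]
      monoidal
    _ = _ := by
      rw [this]
      monoidal

lemma join_mul_split_comul :
    join μ[H] Z ≫ split Δ[H] Z =
      H ◁ split Δ[H] Z ≫ split Δ[H] (H ⊗ H ⊗ Z) ≫ H ◁ cross H H (H ⊗ Z) ≫
        join μ[H] (H ⊗ H ⊗ Z) ≫ H ◁ join μ[H] Z := by
  have := congr($(BimonObj.mul_comul H) ▷ Z)
  calc
    _ = (α_ _ _ _).inv ≫ ((μ[H] ≫ Δ[H]) ▷ Z) ≫ (α_ _ _ _).hom := by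
      simp only [join, split]
      monoidal
    _ = _ := by
      rw [this]
      simp only [join, split, tensorμ, cross, MonoidalCategory.tensorHom_def' Δ[H],
        MonoidalCategory.tensorHom_def μ[H]]
      monoidal

lemma ins_one_del_counit : ins η[H] Z ≫ del ε[H] Z = 𝟙 _ := by
  have := congr($(BimonObj.one_counit H) ▷ Z)
  calc
    _ = (λ_ _).inv ≫ ((η[H] ≫ ε[H]) ▷ Z) ≫ (λ_ _).hom := by
      simp only [ins, del]
      monoidal
    _ = _ := by
      rw [this]
      monoidal

end Bialgebra

variable [HopfObj H]

lemma split_antipode_join :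
    split Δ[H] Z ≫ 𝒮[H] ▷ (H ⊗ Z) ≫ join μ[H] Z = del ε[H] Z ≫ ins η[H] Z := by
  have := congr($(antipode_left H) ▷ Z)
  calc
    _ = ((Δ[H] ≫ 𝒮[H] ▷ H ≫ μ[H]) ▷ Z) := by
      simp only [join, split]
      monoidal
    _ = _ := by
      rw [this]
      simp only [del, ins]
      monoidal

lemma split_whiskerLeft_antipode_join :
    split Δ[H] Z ≫ H ◁ 𝒮[H] ▷ Z ≫ join μ[H] Z = del ε[H] Z ≫ ins η[H] Z := by
  have := congr($(antipode_right H) ▷ Z)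
  calc
    _ = ((Δ[H] ≫ H ◁ 𝒮[H] ≫ μ[H]) ▷ Z) := by
      simp only [join, split]
      monoidal
    _ = _ := by
      rw [this]
      simp only [del, ins]
      monoidal

lemma antipode_split_comul :
    𝒮[H] ▷ Z ≫ split Δ[H] Z =
      split Δ[H] Z ≫ cross H H Z ≫ 𝒮[H] ▷ (H ⊗ Z) ≫ H ◁ 𝒮[H] ▷ Z := by
  have := congr($(antipode_comul H) ▷ Z)
  calc
    _ = ((𝒮[H] ≫ Δ[H]) ▷ Z) ≫ (α_ _ _ _).hom := by
      simp only [split]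
      monoidal
    _ = _ := by
      rw [this]
      simp only [split, cross, MonoidalCategory.tensorHom_def]
      monoidal

lemma join_mul_antipode :
    join μ[H] Z ≫ 𝒮[H] ▷ Z =
      𝒮[H] ▷ (H ⊗ Z) ≫ H ◁ 𝒮[H] ▷ Z ≫ cross H H Z ≫ join μ[H] Z := by
  have := congr($(mul_antipode H) ▷ Z)
  calc
    _ = (α_ _ _ _).inv ≫ ((μ[H] ≫ 𝒮[H]) ▷ Z) := by
      simp only [join]
      monoidal
    _ = _ := by
      rw [this]
      simp only [join, cross, MonoidalCategory.tensorHom_def]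
      monoidal

lemma ins_one_antipode : ins η[H] Z ≫ 𝒮[H] ▷ Z = ins η[H] Z := by
  simp [ins, ← comp_whiskerRight]

lemma antipode_del_counit : 𝒮[H] ▷ Z ≫ del ε[H] Z = del ε[H] Z := by
  simp [del, ← comp_whiskerRight_assoc]

/-- In Sweedler notation, `S(h₁)(h₂ y)₁ ⊗ (h₂ y)₂ = y₁ ⊗ h y₂`. -/
lemma galois_antipode_mul_comul :
    split Δ[H] (H ⊗ Z) ≫ H ◁ join μ[H] Z ≫ H ◁ split Δ[H] Z ≫ 𝒮[H] ▷ (H ⊗ H ⊗ Z) ≫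
        join μ[H] (H ⊗ Z) =
      H ◁ split Δ[H] Z ≫ cross H H (H ⊗ Z) ≫ H ◁ join μ[H] Z := by
  calc
    _ = split Δ[H] (H ⊗ Z) ≫ H ◁ H ◁ split Δ[H] Z ≫ H ◁ split Δ[H] (H ⊗ H ⊗ Z) ≫
          H ◁ H ◁ cross H H (H ⊗ Z) ≫ H ◁ join μ[H] (H ⊗ H ⊗ Z) ≫ H ◁ H ◁ join μ[H] Z ≫
          𝒮[H] ▷ (H ⊗ H ⊗ Z) ≫ join μ[H] (H ⊗ Z) := by
      simp only [← whiskerLeft_comp_assoc, join_mul_split_comul]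
    _ = H ◁ split Δ[H] Z ≫ split Δ[H] (H ⊗ H ⊗ Z) ≫ H ◁ split Δ[H] (H ⊗ H ⊗ Z) ≫
          𝒮[H] ▷ _ ≫ join μ[H] _ ≫ H ◁ cross H H (H ⊗ Z) ≫ join μ[H] (H ⊗ H ⊗ Z) ≫
          H ◁ join μ[H] Z := by
      simp only [whisker_exchange_assoc, ← join_nat, ← reassoc_of% @join_nat,
        ← reassoc_of% @split_nat,
        reassoc_of% @join_mul_assoc]
    _ = H ◁ split Δ[H] Z ≫ ins η[H] _ ≫ H ◁ cross H H (H ⊗ Z) ≫ join μ[H] (H ⊗ H ⊗ Z) ≫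
          H ◁ join μ[H] Z := by
      rw [reassoc_of% @split_comul_assoc, reassoc_of% @split_antipode_join,
        reassoc_of% @split_comul_del]
    _ = _ := by
      rw [reassoc_of% @ins_nat, reassoc_of% @ins_one_join_mul]

end Hopf

/-! ### The projection onto integrals, and the dual of H as a module and comodule -/

section Projection

open HopfObj

universe v u

variable {C : Type u} [Category.{v} C] [MonoidalCategory C] [BraidedCategory C]
  (H : C) (Z : C) [HopfObj H]

/-- The map h ⊗ y ↦ h₁ ⊗ S(h₂)y is a one-sided inverse of the Galois map h ⊗ y ↦ h₁ ⊗ h₂y, since h₁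
⊗ h₂S(h₃)y = h ⊗ y. -/
lemma galois_inv_galois :
    split Δ[H] (H ⊗ Z) ≫ H ◁ 𝒮[H] ▷ (H ⊗ Z) ≫ H ◁ join μ[H] Z ≫ split Δ[H] (H ⊗ Z) ≫
      H ◁ join μ[H] Z = 𝟙 _ := by
  calc
    _ = split Δ[H] (H ⊗ Z) ≫ split Δ[H] (H ⊗ H ⊗ Z) ≫ H ◁ H ◁ 𝒮[H] ▷ (H ⊗ Z) ≫
          H ◁ H ◁ join μ[H] Z ≫ H ◁ join μ[H] Z := by
      simp only [reassoc_of% @split_nat]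
    _ = split Δ[H] (H ⊗ Z) ≫ H ◁ (split Δ[H] (H ⊗ Z) ≫ H ◁ 𝒮[H] ▷ (H ⊗ Z) ≫
          join μ[H] (H ⊗ Z) ≫ join μ[H] Z) := by
      rw [← reassoc_of% @split_comul_assoc]
      simp only [← whiskerLeft_comp, join_mul_assoc]
    _ = _ := by
      rw [reassoc_of% @split_whiskerLeft_antipode_join, ins_one_join_mul, Category.comp_id,
        split_comul_whiskerLeft_del]

/-- In Sweedler notation, `S(h) x₁ ⊗ x₂ = (S(h₂) x)₁ ⊗ h₁ (S(h₂) x)₂`. -/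
lemma antipode_mul_comul :
    H ◁ split Δ[H] Z ≫ 𝒮[H] ▷ (H ⊗ H ⊗ Z) ≫ join μ[H] (H ⊗ Z) =
      split Δ[H] (H ⊗ Z) ≫ H ◁ 𝒮[H] ▷ (H ⊗ Z) ≫ H ◁ join μ[H] Z ≫ H ◁ split Δ[H] Z ≫
        cross H H (H ⊗ Z) ≫ H ◁ join μ[H] Z := by
  rw [← galois_antipode_mul_comul, reassoc_of% @galois_inv_galois]

variable [HasRightDual H]

/-- The right action of `H` on its dual, `(f · h)(x) = f (h x)`. -/
def dualAct : Hᘁ ⊗ H ⟶ Hᘁ :=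
  𝟙 _ ⊗≫ (Hᘁ ⊗ H) ◁ η_ H Hᘁ ⊗≫ Hᘁ ◁ μ[H] ▷ Hᘁ ⊗≫ ε_ H Hᘁ ▷ Hᘁ ⊗≫ 𝟙 _

/-- The left coaction of `H` on its dual, `f₋₁ f₀(x) = f(x₁) x₂`. -/
def dualCoact : Hᘁ ⟶ H ⊗ Hᘁ :=
  𝟙 _ ⊗≫ Hᘁ ◁ η_ H Hᘁ ⊗≫ Hᘁ ◁ Δ[H] ▷ Hᘁ ⊗≫ ε_ H Hᘁ ▷ (H ⊗ Hᘁ) ⊗≫ 𝟙 _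

/-- In terms of dual bases, the endomorphism `x ↦ (eᵢ)₁ eⁱ(S²((eᵢ)₂) x)` of `H`. -/
def intProj : H ⟶ H :=
  𝟙 _ ⊗≫ η_ H Hᘁ ▷ H ⊗≫ Δ[H] ▷ (Hᘁ ⊗ H) ⊗≫ H ◁ (β_ H Hᘁ).hom ▷ H ⊗≫
    (H ⊗ Hᘁ) ◁ (𝒮[H] ≫ 𝒮[H]) ▷ H ⊗≫ (H ⊗ Hᘁ) ◁ μ[H] ⊗≫ H ◁ ε_ H Hᘁ ⊗≫ 𝟙 _

lemma join_dualAct :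
    join (dualAct H) Z = Hᘁ ◁ H ◁ cup (η_ H Hᘁ) Z ≫ Hᘁ ◁ join μ[H] (Hᘁ ⊗ Z) ≫
      cap (ε_ H Hᘁ) (Hᘁ ⊗ Z) := by
  simp only [join, dualAct, cup, cap]
  monoidal

lemma split_dualCoact :
    split (dualCoact H) Z = Hᘁ ◁ cup (η_ H Hᘁ) Z ≫ Hᘁ ◁ split Δ[H] (Hᘁ ⊗ Z) ≫
      cap (ε_ H Hᘁ) (H ⊗ Hᘁ ⊗ Z) := by
  simp only [split, dualCoact, cup, cap]
  monoidal

lemma intProj_whiskerRight :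
    intProj H ▷ Z = cup (η_ H Hᘁ) (H ⊗ Z) ≫ split Δ[H] (Hᘁ ⊗ H ⊗ Z) ≫
      H ◁ cross H Hᘁ (H ⊗ Z) ≫ H ◁ Hᘁ ◁ 𝒮[H] ▷ (H ⊗ Z) ≫ H ◁ Hᘁ ◁ 𝒮[H] ▷ (H ⊗ Z) ≫
      H ◁ Hᘁ ◁ join μ[H] Z ≫ H ◁ cap (ε_ H Hᘁ) Z := by
  simp only [intProj, cup, cap, split, cross, join]
  monoidal

lemma join_dualAct_cap :
    join (dualAct H) (H ⊗ Z) ≫ cap (ε_ H Hᘁ) Z = Hᘁ ◁ join μ[H] Z ≫ cap (ε_ H Hᘁ) Z := by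
  simp only [join_dualAct, Category.assoc, cap_nat]
  simp only [← whiskerLeft_comp_assoc, join_nat, cup_cap, whiskerLeft_id, Category.id_comp]

lemma cap_comul :
    Hᘁ ◁ split Δ[H] Z ≫ cap (ε_ H Hᘁ) (H ⊗ Z) =
      split (dualCoact H) (H ⊗ Z) ≫ H ◁ cap (ε_ H Hᘁ) Z := by
  simp only [split_dualCoact, Category.assoc, cap_nat]
  simp only [← whiskerLeft_comp_assoc, split_nat]
  simp only [reassoc_of% @cup_cap]

/-- Moves a multiplication across the dual bases: h eᵢ ⊗ eⁱ = eᵢ ⊗ eⁱ · h. -/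
lemma cup_dualAct :
    H ◁ cup (η_ H Hᘁ) Z ≫ join μ[H] (Hᘁ ⊗ Z) =
      cup (η_ H Hᘁ) (H ⊗ Z) ≫ H ◁ join (dualAct H) Z := by
  simp only [join_dualAct, whiskerLeft_comp, reassoc_of% @cup_nat, cup_cap, Category.comp_id]

lemma cup_dualCoact :
    cup (η_ H Hᘁ) Z ≫ H ◁ split (dualCoact H) Z =
      cup (η_ H Hᘁ) Z ≫ split Δ[H] (Hᘁ ⊗ Z) := by
  simp only [split_dualCoact, whiskerLeft_comp, reassoc_of% @cup_nat, cup_cap, Category.comp_id]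

end Projection

/-! ### The projection is a left integral in H -/

section LeftInvariance

open HopfObj

universe v u

variable {C : Type u} [Category.{v} C] [MonoidalCategory C] [BraidedCategory C]
  (H : C) (Z : C) [HopfObj H]

/-- Anti-multiplicativity of S in the form S(b)S²(a) = S(S(a)b). -/
lemma cross_antipode_antipode_join_join :
    H ◁ 𝒮[H] ▷ (H ⊗ Z) ≫ cross H H (H ⊗ Z) ≫ H ◁ 𝒮[H] ▷ (H ⊗ Z) ≫ H ◁ 𝒮[H] ▷ (H ⊗ Z) ≫
        H ◁ join μ[H] Z ≫ join μ[H] Z =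
      𝒮[H] ▷ (H ⊗ H ⊗ Z) ≫ join μ[H] (H ⊗ Z) ≫ 𝒮[H] ▷ (H ⊗ Z) ≫ join μ[H] Z := by
  simp only [join_mul_assoc, reassoc_of% @join_mul_antipode, whisker_exchange_assoc,
    reassoc_of% @cross_nat_left,
    reassoc_of% @cross_nat_right]

lemma join_mul_cross_antipode (A : C) :
    join μ[H] (A ⊗ Z) ≫ cross H A Z ≫ A ◁ 𝒮[H] ▷ Z =
      cross H H (A ⊗ Z) ≫ H ◁ cross H A Z ≫ cross H A (H ⊗ Z) ≫
        A ◁ (𝒮[H] ▷ (H ⊗ Z) ≫ H ◁ 𝒮[H] ▷ Z ≫ join μ[H] Z) := by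
  have key : cross H H Z ≫ 𝒮[H] ▷ (H ⊗ Z) ≫ H ◁ 𝒮[H] ▷ Z ≫ join μ[H] Z =
      join μ[H] Z ≫ 𝒮[H] ▷ Z := by
    rw [join_mul_antipode, reassoc_of% @cross_nat_right, reassoc_of% @cross_nat_left,
      whisker_exchange_assoc]
  rw [reassoc_of% @cross_yang_baxter, ← whiskerLeft_comp, key, reassoc_of% @join_cross,
    whiskerLeft_comp]

variable [HasRightDual H]

/-- By `antipode_mul_comul`, S(h)P(x) has S(h₂)eᵢ in place of eᵢ and an extra h₁ before its second
leg. Transferring S(h₂) to eⁱ gives (eᵢ)₁ eⁱ(S(h₂) S²(h₁(eᵢ)₂) x). Here S(h₂)S²(h₁(eᵢ)₂) =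
S(S((eᵢ)₂)S(h₁)h₂), and S(h₁)h₂ collapses to ε(h). -/
lemma antipode_intProj_join :
    𝒮[H] ▷ (H ⊗ Z) ≫ H ◁ intProj H ▷ Z ≫ join μ[H] Z = del ε[H] (H ⊗ Z) ≫ intProj H ▷ Z := by
  rw [intProj_whiskerRight]
  calc
    _ = H ◁ cup (η_ H Hᘁ) (H ⊗ Z) ≫ H ◁ split Δ[H] (Hᘁ ⊗ H ⊗ Z) ≫ 𝒮[H] ▷ _ ≫ join μ[H] _ ≫
          H ◁ cross H Hᘁ (H ⊗ Z) ≫ H ◁ Hᘁ ◁ 𝒮[H] ▷ (H ⊗ Z) ≫ H ◁ Hᘁ ◁ 𝒮[H] ▷ (H ⊗ Z) ≫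
          H ◁ Hᘁ ◁ join μ[H] Z ≫ H ◁ cap (ε_ H Hᘁ) Z := by
      simp only [whiskerLeft_comp, Category.assoc, whisker_exchange_assoc, join_nat,
        reassoc_of% @join_nat]
    _ = split Δ[H] (H ⊗ Z) ≫ H ◁ 𝒮[H] ▷ (H ⊗ Z) ≫
          H ◁ (H ◁ cup (η_ H Hᘁ) (H ⊗ Z) ≫ join μ[H] (Hᘁ ⊗ H ⊗ Z)) ≫
          H ◁ split Δ[H] (Hᘁ ⊗ H ⊗ Z) ≫ cross H H _ ≫ H ◁ join μ[H] _ ≫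
          H ◁ cross H Hᘁ (H ⊗ Z) ≫ H ◁ Hᘁ ◁ 𝒮[H] ▷ (H ⊗ Z) ≫ H ◁ Hᘁ ◁ 𝒮[H] ▷ (H ⊗ Z) ≫
          H ◁ Hᘁ ◁ join μ[H] Z ≫ H ◁ cap (ε_ H Hᘁ) Z := by
      rw [reassoc_of% @antipode_mul_comul, ← reassoc_of% @split_nat, whiskerLeft_comp,
        Category.assoc,
        ← whiskerLeft_comp_assoc H (H ◁ cup (η_ H Hᘁ) _), whisker_exchange, whiskerLeft_comp_assoc]
    _ = split Δ[H] (H ⊗ Z) ≫ H ◁ 𝒮[H] ▷ (H ⊗ Z) ≫ H ◁ cup (η_ H Hᘁ) (H ⊗ H ⊗ Z) ≫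
          H ◁ split Δ[H] _ ≫ cross H H _ ≫ H ◁ join μ[H] _ ≫
          H ◁ (H ◁ join (dualAct H) (H ⊗ Z) ≫ cross H Hᘁ (H ⊗ Z) ≫ Hᘁ ◁ 𝒮[H] ▷ (H ⊗ Z) ≫
            Hᘁ ◁ 𝒮[H] ▷ (H ⊗ Z) ≫ Hᘁ ◁ join μ[H] Z ≫ cap (ε_ H Hᘁ) Z) := by
      rw [cup_dualAct]
      simp only [whiskerLeft_comp, Category.assoc]
      rw [← whiskerLeft_comp_assoc H (H ◁ _), ← split_nat, whiskerLeft_comp_assoc,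
        ← reassoc_of% @cross_nat, ← whiskerLeft_comp_assoc H (H ◁ _), ← join_nat,
        whiskerLeft_comp_assoc]
    _ = split Δ[H] (H ⊗ Z) ≫ H ◁ 𝒮[H] ▷ (H ⊗ Z) ≫ H ◁ cup (η_ H Hᘁ) (H ⊗ H ⊗ Z) ≫
          H ◁ split Δ[H] _ ≫ cross H H _ ≫ H ◁ join μ[H] _ ≫ H ◁ cross H Hᘁ (H ⊗ H ⊗ Z) ≫
          H ◁ Hᘁ ◁ (cross H H (H ⊗ Z) ≫ H ◁ 𝒮[H] ▷ (H ⊗ Z) ≫ H ◁ 𝒮[H] ▷ (H ⊗ Z) ≫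
            H ◁ join μ[H] Z ≫ join μ[H] Z) ≫ H ◁ cap (ε_ H Hᘁ) Z := by
      rw [reassoc_of% @cross_join, reassoc_of% @join_nat, reassoc_of% @join_nat,
        reassoc_of% @join_nat, join_dualAct_cap]
      simp only [whiskerLeft_comp, Category.assoc]
    _ = split Δ[H] (H ⊗ Z) ≫ H ◁ cup (η_ H Hᘁ) (H ⊗ H ⊗ Z) ≫
          H ◁ split Δ[H] _ ≫ cross H H _ ≫ H ◁ join μ[H] _ ≫ H ◁ cross H Hᘁ (H ⊗ H ⊗ Z) ≫
          H ◁ Hᘁ ◁ (𝒮[H] ▷ (H ⊗ H ⊗ Z) ≫ join μ[H] (H ⊗ Z) ≫ 𝒮[H] ▷ (H ⊗ Z) ≫ join μ[H] Z) ≫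
          H ◁ cap (ε_ H Hᘁ) Z := by
      rw [← cross_antipode_antipode_join_join, ← whiskerLeft_comp_assoc H (𝒮[H] ▷ _), ← cup_nat,
        whiskerLeft_comp_assoc, ← whiskerLeft_comp_assoc H (H ◁ _), ← split_nat,
        whiskerLeft_comp_assoc, ← reassoc_of% @cross_nat, ← whiskerLeft_comp_assoc H (H ◁ _),
        ← join_nat, whiskerLeft_comp_assoc, ← whiskerLeft_comp_assoc H (H ◁ _), ← cross_nat]
      simp only [whiskerLeft_comp, Category.assoc]
    _ = split Δ[H] (H ⊗ Z) ≫ H ◁ cup (η_ H Hᘁ) (H ⊗ H ⊗ Z) ≫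
          H ◁ split Δ[H] _ ≫ cross H H _ ≫ H ◁ cross H H _ ≫ H ◁ H ◁ cross H Hᘁ (H ⊗ H ⊗ Z) ≫
          H ◁ cross H Hᘁ _ ≫ H ◁ Hᘁ ◁ (𝒮[H] ▷ _ ≫ H ◁ 𝒮[H] ▷ (H ⊗ H ⊗ Z) ≫
          join μ[H] _ ≫ join μ[H] (H ⊗ Z) ≫ 𝒮[H] ▷ (H ⊗ Z) ≫ join μ[H] Z) ≫
          H ◁ cap (ε_ H Hᘁ) Z := by
      have key := congr(H ◁ $(join_mul_cross_antipode H (H ⊗ H ⊗ Z) Hᘁ))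
      simp only [whiskerLeft_comp, Category.assoc] at key ⊢
      rw [reassoc_of% key]
    _ = split Δ[H] (H ⊗ Z) ≫ cup (η_ H Hᘁ) _ ≫ split Δ[H] _ ≫ H ◁ cross H Hᘁ _ ≫
          H ◁ Hᘁ ◁ (𝒮[H] ▷ _ ≫ H ◁ 𝒮[H] ▷ (H ⊗ H ⊗ Z) ≫ join μ[H] _ ≫ join μ[H] (H ⊗ Z) ≫
            𝒮[H] ▷ (H ⊗ Z) ≫ join μ[H] Z) ≫ H ◁ cap (ε_ H Hᘁ) Z := by
      rw [reassoc_of% @cross_split, reassoc_of% @split_nat, reassoc_of% @cross_cup]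
    -- The product S(h₁)h₂ involves neither eᵢ nor eⁱ, so it slides ahead of the coevaluation.
    _ = split Δ[H] (H ⊗ Z) ≫ 𝒮[H] ▷ (H ⊗ H ⊗ Z) ≫ join μ[H] (H ⊗ Z) ≫
          cup (η_ H Hᘁ) _ ≫ split Δ[H] _ ≫ H ◁ cross H Hᘁ _ ≫
          H ◁ Hᘁ ◁ (𝒮[H] ▷ _ ≫ join μ[H] (H ⊗ Z) ≫
            𝒮[H] ▷ (H ⊗ Z) ≫ join μ[H] Z) ≫ H ◁ cap (ε_ H Hᘁ) Z := by
      have inner : 𝒮[H] ▷ _ ≫ H ◁ 𝒮[H] ▷ (H ⊗ H ⊗ Z) ≫ join μ[H] _ ≫ join μ[H] (H ⊗ Z) =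
          H ◁ (𝒮[H] ▷ (H ⊗ H ⊗ Z) ≫ join μ[H] (H ⊗ Z)) ≫ 𝒮[H] ▷ _ ≫ join μ[H] (H ⊗ Z) := by
        rw [whiskerLeft_comp_assoc, whisker_exchange_assoc, join_mul_assoc, whisker_exchange_assoc]
      have key := congr(H ◁ $(cross_nat (A := H) (B := Hᘁ)
        (𝒮[H] ▷ (H ⊗ H ⊗ Z) ≫ join μ[H] (H ⊗ Z))))
      rw [reassoc_of% inner, whiskerLeft_comp, whiskerLeft_comp, Category.assoc]
      rw [whiskerLeft_comp H (cross _ _ _), whiskerLeft_comp H (H ◁ _)] at key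
      rw [reassoc_of% key, reassoc_of% @split_nat, reassoc_of% @cup_nat, Category.assoc]
    _ = _ := by
      rw [reassoc_of% @split_antipode_join, ← reassoc_of% @cup_nat, ← reassoc_of% @split_nat]
      have key := congr(H ◁ $(cross_nat (A := H) (B := Hᘁ) (ins η[H] (H ⊗ Z))))
      simp only [whiskerLeft_comp, Category.assoc] at key ⊢
      rw [← reassoc_of% key]
      simp only [← whiskerLeft_comp_assoc, whisker_exchange_assoc,
        reassoc_of% @whiskerLeft_ins_one_join_mul]

end LeftInvariance

/-! ### The projection is a right integral on H, fixes integrals, and has twisted trace 1 -/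

section RightInvariance

open HopfObj

universe v u

variable {C : Type u} [Category.{v} C] [MonoidalCategory C] [BraidedCategory C]
  (H : C) (Z : C) [HopfObj H]

lemma split_comul_rightIntegral {X : C} {f : H ⟶ X} (hf : IsRightIntegralOn f) :
    split Δ[H] Z ≫ f ▷ (H ⊗ Z) = f ▷ Z ≫ X ◁ ins η[H] Z := by
  have := congr($hf ▷ Z)
  calc
    _ = ((Δ[H] ≫ f ▷ H) ▷ Z) ≫ (α_ _ _ _).hom := by
      simp only [split]
      monoidal
    _ = _ := by
      rw [this]
      simp only [ins]
      monoidal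

lemma leftIntegral_join_mul {X : C} {f : X ⟶ H} (hf : IsLeftIntegralIn f) :
    H ◁ f ▷ Z ≫ join μ[H] Z = del ε[H] (X ⊗ Z) ≫ f ▷ Z := by
  have := congr($hf ▷ Z)
  calc
    _ = (α_ _ _ _).inv ≫ ((H ◁ f ≫ μ[H]) ▷ Z) := by
      simp only [join]
      monoidal
    _ = _ := by
      rw [this]
      simp only [del]
      monoidal

variable [HasRightDual H]

lemma cross_antipode_cross_join_cap {W : C} (y : W ⟶ H ⊗ H ⊗ Z) :
    cross H Hᘁ W ≫ Hᘁ ◁ 𝒮[H] ▷ W ≫ Hᘁ ◁ H ◁ y ≫ Hᘁ ◁ cross H H (H ⊗ Z) ≫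
        Hᘁ ◁ H ◁ join μ[H] Z ≫ cap (ε_ H Hᘁ) (H ⊗ Z) =
      𝒮[H] ▷ (Hᘁ ⊗ W) ≫ H ◁ Hᘁ ◁ y ≫ H ◁ cap (ε_ H Hᘁ) (H ⊗ Z) ≫ join μ[H] Z := by
  rw [← cap_nat, ← reassoc_of% @cross_nat_left, reassoc_of% @cross_nat, reassoc_of% @cross_cap]

/-- Apply `antipode_mul_comul` with h = S(e₂), where e = eᵢ: P(x₁) ⊗ x₂ becomes e₁ eⁱ((S²(e₂)x)₁) ⊗
S(e₃)(S²(e₂)x)₂. The coaction on the dual turns the last factor into a fourth leg of e, and S(e₃)e₄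
collapses. -/
lemma comul_intProj :
    split Δ[H] Z ≫ intProj H ▷ (H ⊗ Z) = intProj H ▷ Z ≫ H ◁ ins η[H] Z := by
  rw [intProj_whiskerRight, intProj_whiskerRight]
  calc
    _ = cup (η_ H Hᘁ) (H ⊗ Z) ≫ split Δ[H] (Hᘁ ⊗ H ⊗ Z) ≫ H ◁ (cross H Hᘁ (H ⊗ Z) ≫
          Hᘁ ◁ (𝒮[H] ▷ (H ⊗ Z) ≫ H ◁ split Δ[H] Z ≫ 𝒮[H] ▷ (H ⊗ H ⊗ Z) ≫ join μ[H] (H ⊗ Z)) ≫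
          cap (ε_ H Hᘁ) (H ⊗ Z)) := by
      rw [← reassoc_of% @cup_nat, ← reassoc_of% @split_nat]
      simp only [← whiskerLeft_comp]
      rw [← reassoc_of% @cross_nat]
      simp only [whiskerLeft_comp, Category.assoc]
      simp only [← whiskerLeft_comp, ← whiskerLeft_comp_assoc, whisker_exchange_assoc]
    _ = cup (η_ H Hᘁ) (H ⊗ Z) ≫ split Δ[H] (Hᘁ ⊗ H ⊗ Z) ≫ H ◁ (cross H Hᘁ (H ⊗ Z) ≫
          Hᘁ ◁ split Δ[H] (H ⊗ Z) ≫ Hᘁ ◁ cross H H (H ⊗ Z) ≫ Hᘁ ◁ 𝒮[H] ▷ _ ≫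
          Hᘁ ◁ H ◁ (𝒮[H] ▷ (H ⊗ Z) ≫ 𝒮[H] ▷ (H ⊗ Z) ≫ join μ[H] Z ≫ split Δ[H] Z) ≫
          Hᘁ ◁ cross H H (H ⊗ Z) ≫ Hᘁ ◁ H ◁ join μ[H] Z ≫ cap (ε_ H Hᘁ) (H ⊗ Z)) := by
      rw [antipode_mul_comul, reassoc_of% @antipode_split_comul]
      simp only [whiskerLeft_comp, Category.assoc]
    _ = cup (η_ H Hᘁ) (H ⊗ Z) ≫ split Δ[H] (Hᘁ ⊗ H ⊗ Z) ≫ H ◁ (split Δ[H] (Hᘁ ⊗ H ⊗ Z) ≫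
          cross H H (Hᘁ ⊗ H ⊗ Z) ≫ H ◁ cross H Hᘁ (H ⊗ Z) ≫ 𝒮[H] ▷ _ ≫
          H ◁ Hᘁ ◁ (𝒮[H] ▷ (H ⊗ Z) ≫ 𝒮[H] ▷ (H ⊗ Z) ≫ join μ[H] Z) ≫
          H ◁ (Hᘁ ◁ split Δ[H] Z ≫ cap (ε_ H Hᘁ) (H ⊗ Z)) ≫ join μ[H] Z) := by
      rw [← reassoc_of% @split_cross, ← reassoc_of% @cross_yang_baxter,
        cross_antipode_cross_join_cap]
      simp only [whiskerLeft_comp, Category.assoc]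
    _ = cup (η_ H Hᘁ) (H ⊗ Z) ≫ H ◁ split (dualCoact H) (H ⊗ Z) ≫
          split Δ[H] (H ⊗ Hᘁ ⊗ H ⊗ Z) ≫ H ◁ (split Δ[H] (H ⊗ Hᘁ ⊗ H ⊗ Z) ≫
          cross H H _ ≫ H ◁ cross H H _ ≫ H ◁ H ◁ cross H Hᘁ (H ⊗ Z) ≫ 𝒮[H] ▷ _ ≫
          H ◁ H ◁ Hᘁ ◁ (𝒮[H] ▷ (H ⊗ Z) ≫ 𝒮[H] ▷ (H ⊗ Z) ≫ join μ[H] Z) ≫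
          H ◁ H ◁ cap (ε_ H Hᘁ) Z ≫ join μ[H] Z) := by
      have key {W : C} (y : H ⊗ H ⊗ Z ⟶ W) :
          cross H Hᘁ (H ⊗ Z) ≫ Hᘁ ◁ y ≫ split (dualCoact H) W =
            H ◁ split (dualCoact H) (H ⊗ Z) ≫ cross H H _ ≫ H ◁ cross H Hᘁ (H ⊗ Z) ≫
              H ◁ Hᘁ ◁ y := by
        rw [← split_nat, reassoc_of% @cross_split]
      have key' := congr(H ◁ $(key (𝒮[H] ▷ (H ⊗ Z) ≫ 𝒮[H] ▷ (H ⊗ Z) ≫ join μ[H] Z)))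
      rw [whiskerLeft_comp, whiskerLeft_comp] at key'
      simp only [cap_comul, ← whisker_exchange_assoc]
      rw [whiskerLeft_comp H (split (dualCoact H) _), Category.assoc, reassoc_of% key']
      rw [whiskerLeft_comp H (H ◁ _), Category.assoc, reassoc_of% @cross_nat,
        reassoc_of% @split_nat,
        whiskerLeft_comp H (H ◁ _), reassoc_of% @split_nat]
      simp only [whiskerLeft_comp, Category.assoc]
    -- Coassociativity regroups the four legs of eᵢ so that the last two come from a single
    -- comultiplication.
    _ = cup (η_ H Hᘁ) (H ⊗ Z) ≫ split Δ[H] (Hᘁ ⊗ H ⊗ Z) ≫ H ◁ (split Δ[H] (Hᘁ ⊗ H ⊗ Z) ≫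
          cross H H (Hᘁ ⊗ H ⊗ Z) ≫ split Δ[H] _ ≫ 𝒮[H] ▷ _ ≫ join μ[H] _ ≫
          H ◁ (cross H Hᘁ (H ⊗ Z) ≫ Hᘁ ◁ (𝒮[H] ▷ (H ⊗ Z) ≫ 𝒮[H] ▷ (H ⊗ Z) ≫ join μ[H] Z) ≫
          cap (ε_ H Hᘁ) Z)) := by
      rw [reassoc_of% cup_dualCoact, ← reassoc_of% @split_comul_assoc,
        ← whiskerLeft_comp H (split _ _),
        ← reassoc_of% @split_comul_assoc, join_nat, whisker_exchange_assoc,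
        ← reassoc_of% @cross_split]
      simp only [whiskerLeft_comp, Category.assoc]
    _ = _ := by
      rw [reassoc_of% @split_antipode_join, reassoc_of% @cross_del,
        reassoc_of% @split_comul_whiskerLeft_del, ins_nat]
      simp only [whiskerLeft_comp, Category.assoc]

/-- Invariance replaces f(e₁) ⊗ e₂ by f(e) ⊗ 1, leaving f(eᵢ)eⁱ(x) = f(x). -/
lemma intProj_comp_rightIntegral {X : C} {f : H ⟶ X} (hf : IsRightIntegralOn f) :
    intProj H ≫ f = f := by
  rw [← whiskerRight_iff, comp_whiskerRight, intProj_whiskerRight]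
  simp only [Category.assoc, whisker_exchange]
  simp only [whisker_exchange_assoc, reassoc_of% split_comul_rightIntegral H _ hf]
  simp only [← whiskerLeft_comp, ← whiskerLeft_comp_assoc, reassoc_of% @ins_cross,
    reassoc_of% @ins_one_antipode,
    ins_one_join_mul]
  simp only [whiskerLeft_id, Category.id_comp, ← whisker_exchange, reassoc_of% @cup_cap]

/-- On an integral, S²(e₂) acts through ε(S²(e₂)) = ε(e₂), leaving eᵢ eⁱ. -/
lemma leftIntegral_comp_intProj {X : C} {f : X ⟶ H} (hf : IsLeftIntegralIn f) :
    f ≫ intProj H = f := by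
  rw [← whiskerRight_iff, comp_whiskerRight, intProj_whiskerRight, ← reassoc_of% @cup_nat,
    ← reassoc_of% @split_nat]
  simp only [← whiskerLeft_comp]
  rw [← reassoc_of% @cross_nat]
  simp only [← whiskerLeft_comp_assoc, whisker_exchange_assoc, leftIntegral_join_mul H _ hf,
    reassoc_of% @antipode_del_counit]
  simp only [whiskerLeft_comp, Category.assoc, ← whiskerLeft_comp_assoc H (cross _ _ _),
    del_cross, reassoc_of% @split_comul_whiskerLeft_del, reassoc_of% @cup_nat, cup_cap,
    Category.comp_id]

/-- The trace of S ∘ P is eⁱ(S²(e₂)S(e₁)) = eⁱ(S(e₁S(e₂))) with e = eᵢ, that is ε(1) = 1. -/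
lemma cup_intProj_cross_antipode_cap :
    cup (η_ H Hᘁ) Z ≫ intProj H ▷ (Hᘁ ⊗ Z) ≫ cross H Hᘁ Z ≫ Hᘁ ◁ 𝒮[H] ▷ Z ≫
      cap (ε_ H Hᘁ) Z = 𝟙 Z := by
  rw [intProj_whiskerRight]
  calc
    _ = cup (η_ H Hᘁ) Z ≫ split Δ[H] (Hᘁ ⊗ Z) ≫ H ◁ cross H Hᘁ Z ≫ H ◁ Hᘁ ◁ 𝒮[H] ▷ Z ≫
          H ◁ Hᘁ ◁ 𝒮[H] ▷ Z ≫ H ◁ join (dualAct H) Z ≫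
          cross H Hᘁ Z ≫ Hᘁ ◁ 𝒮[H] ▷ Z ≫ cap (ε_ H Hᘁ) Z := by
      simp only [Category.assoc]
      rw [← reassoc_of% @cup_nat, ← reassoc_of% @split_nat]
      rw [← whiskerLeft_comp_assoc H (H ◁ _), ← cross_nat]
      simp only [join_dualAct, ← whiskerLeft_comp_assoc, Category.assoc, whisker_exchange_assoc]
    _ = cup (η_ H Hᘁ) Z ≫ split Δ[H] (Hᘁ ⊗ Z) ≫ H ◁ cross H Hᘁ Z ≫ cross H Hᘁ _ ≫
          Hᘁ ◁ (H ◁ 𝒮[H] ▷ Z ≫ H ◁ 𝒮[H] ▷ Z ≫ cross H H Z ≫ H ◁ 𝒮[H] ▷ Z ≫ join μ[H] Z) ≫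
          cap (ε_ H Hᘁ) Z := by
      rw [reassoc_of% @cross_join, reassoc_of% @join_nat, join_dualAct_cap,
        ← reassoc_of% @cross_nat, ← reassoc_of% @cross_nat]
      simp only [whiskerLeft_comp, Category.assoc]
    _ = cup (η_ H Hᘁ) Z ≫ cross H Hᘁ Z ≫ Hᘁ ◁ (split Δ[H] Z ≫ H ◁ 𝒮[H] ▷ Z ≫ join μ[H] Z ≫
          𝒮[H] ▷ Z) ≫ cap (ε_ H Hᘁ) Z := by
      rw [reassoc_of% @split_cross, join_mul_antipode, ← whisker_exchange_assoc,
        reassoc_of% @cross_nat_left]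
      simp only [whiskerLeft_comp, Category.assoc]
    _ = _ := by
      rw [reassoc_of% @split_whiskerLeft_antipode_join, ins_one_antipode]
      rw [whiskerLeft_comp_assoc, reassoc_of% @del_cross, reassoc_of% @del_nat,
        reassoc_of% @cup_nat, del_nat,
        reassoc_of% @cup_cap, ins_one_del_counit]

end RightInvariance

/-! ### Invertibility criterion, exchange of sides by the antipode, and the self-braiding of I -/

open HopfObj

universe v u

variable {C : Type u} [Category.{v} C] [MonoidalCategory C]

section Mates

lemma cup_rightAdjointMate {X Y : C} [HasRightDual X] [HasRightDual Y] (f : X ⟶ Y) (Z : C) :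
    cup (η_ Y Yᘁ) Z ≫ Y ◁ (fᘁ) ▷ Z = cup (η_ X Xᘁ) Z ≫ f ▷ (Xᘁ ⊗ Z) := by
  have := congr($(coevaluation_comp_rightAdjointMate f) ▷ Z)
  calc
    _ = (λ_ Z).inv ≫ ((η_ Y Yᘁ ≫ Y ◁ (fᘁ)) ▷ Z) ≫ (α_ _ _ _).hom := by
      simp only [cup]
      monoidal
    _ = _ := by
      rw [this]
      simp only [cup]
      monoidal

lemma rightAdjointMate_cap {X Y : C} [HasRightDual X] [HasRightDual Y] (f : X ⟶ Y) (Z : C) :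
    (fᘁ) ▷ (X ⊗ Z) ≫ cap (ε_ X Xᘁ) Z = Yᘁ ◁ f ▷ Z ≫ cap (ε_ Y Yᘁ) Z := by
  have := congr($(rightAdjointMate_comp_evaluation f) ▷ Z)
  calc
    _ = (α_ _ _ _).inv ≫ ((fᘁ ▷ X ≫ ε_ X Xᘁ) ▷ Z) ≫ (λ_ _).hom := by
      simp only [cap]
      monoidal
    _ = _ := by
      rw [this]
      simp only [cap]
      monoidal

end Mates

variable [BraidedCategory C]

/-- The braided evaluation twisted by t is inverse to the coevaluation. One composite is `htr`. In
the other, t becomes a self-braiding of I, the evaluation slides past the strand, and a zigzag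
remains. -/
lemma isInvertibleObj_of_cross {I : C} [HasRightDual I] (t : I ⟶ I)
    (ht : ∀ Z, cross I I Z = t ▷ (I ⊗ Z))
    (htr : cup (η_ I Iᘁ) (𝟙_ C) ≫ cross I Iᘁ (𝟙_ C) ≫ Iᘁ ◁ t ▷ 𝟙_ C ≫ cap (ε_ I Iᘁ) (𝟙_ C) = 𝟙 _) :
    IsInvertibleObj I := by
  -- The inverse is the dual of I; the factor `𝟙_ C` is the empty tail of the word.
  refine ⟨Iᘁ ⊗ 𝟙_ C, ⟨⟨cross I Iᘁ (𝟙_ C) ≫ Iᘁ ◁ t ▷ 𝟙_ C ≫ cap (ε_ I Iᘁ) (𝟙_ C),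
    cup (η_ I Iᘁ) (𝟙_ C), ?_, htr⟩⟩⟩
  simp only [Category.assoc]
  rw [cap_nat, ← whiskerLeft_comp_assoc, ← whisker_exchange, whiskerLeft_comp_assoc,
    reassoc_of% @cross_nat, ← ht, cross_cap, ← whiskerLeft_comp, cap_cup, whiskerLeft_id]

section Integrals

variable {H X Y : C}

section Bimonoid

variable [BimonObj H]

lemma IsRightIntegralOn.comp {f : H ⟶ X} (hf : IsRightIntegralOn f) (g : X ⟶ Y) :
    IsRightIntegralOn (f ≫ g) := by
  simp only [IsRightIntegralOn] at hf ⊢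
  simp [reassoc_of% hf, whisker_exchange]

lemma IsLeftIntegralIn.comp {f : X ⟶ H} (hf : IsLeftIntegralIn f) (g : Y ⟶ X) :
    IsLeftIntegralIn (g ≫ f) := by
  simp only [IsLeftIntegralIn] at hf ⊢
  simp [hf, whisker_exchange_assoc]

lemma rightIntegral_join_mul {f : X ⟶ H} (hf : IsRightIntegralIn f) (Z : C) :
    f ▷ (H ⊗ Z) ≫ join μ[H] Z = X ◁ del ε[H] Z ≫ f ▷ Z := by
  have := congr($hf ▷ Z)
  calc
    _ = (α_ _ _ _).inv ≫ ((f ▷ H ≫ μ[H]) ▷ Z) := by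
      simp only [join]
      monoidal
    _ = _ := by
      rw [this]
      simp only [del]
      monoidal

end Bimonoid

variable [HopfObj H]

/-- For Λ = f(x), g(S(h)Λ₁) ⊗ Λ₂ = g(Λ) ⊗ h: write h ⊗ Λ as h₁ ⊗ h₂Λ, apply
`galois_antipode_mul_comul` to reach g(Λ₁) ⊗ hΛ₂, and use invariance of g. -/
lemma leftIntegral_antipode_rightIntegral {f : X ⟶ H} (hf : IsLeftIntegralIn f)
    {g : H ⟶ Y} (hg : IsRightIntegralOn g) (Z : C) :
    H ◁ f ▷ Z ≫ H ◁ split Δ[H] Z ≫ 𝒮[H] ▷ (H ⊗ H ⊗ Z) ≫ join μ[H] (H ⊗ Z) ≫ g ▷ (H ⊗ Z) =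
      cross H X Z ≫ (f ≫ g) ▷ (H ⊗ Z) := by
  have hf' : H ◁ f ▷ Z = split Δ[H] _ ≫ H ◁ H ◁ f ▷ Z ≫ H ◁ join μ[H] Z := by
    rw [← whiskerLeft_comp, leftIntegral_join_mul _ _ hf, whiskerLeft_comp,
      reassoc_of% @split_comul_whiskerLeft_del]
  rw [hf']
  simp only [Category.assoc]
  rw [reassoc_of% @split_nat, reassoc_of% @galois_antipode_mul_comul, whisker_exchange,
    ← reassoc_of% @cross_nat_right, ← whiskerLeft_comp_assoc H (split _ _),
    split_comul_rightIntegral _ _ hg, whiskerLeft_comp_assoc, ← reassoc_of% @cross_nat,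
    ← whiskerLeft_comp, whiskerLeft_ins_one_join_mul, whiskerLeft_id, Category.comp_id,
    ← whiskerLeft_comp_assoc, ← comp_whiskerRight, cross_nat_right]

lemma IsRightIntegralOn.antipode_comp [IsIso 𝒮[H]] {f : H ⟶ X} (hf : IsRightIntegralOn f) :
    IsLeftIntegralOn (𝒮[H] ≫ f) := by
  simp only [IsRightIntegralOn, IsLeftIntegralOn] at hf ⊢
  have h : Δ[H] ≫ H ◁ 𝒮[H] ≫ 𝒮[H] ▷ H = 𝒮[H] ≫ Δ[H] ≫ (β_ H H).inv := by
    rw [← cancel_mono (β_ H H).hom]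
    simp [antipode_comul, MonoidalCategory.tensorHom_def]
  -- An extra S on the free leg makes anti-comultiplicativity applicable; it is invertible and fixes
  -- the unit.
  rw [← cancel_mono (𝒮[H] ▷ X)]
  calc
    _ = (Δ[H] ≫ H ◁ 𝒮[H] ≫ 𝒮[H] ▷ H) ≫ H ◁ f := by simp [whisker_exchange, whisker_exchange_assoc]
    _ = 𝒮[H] ≫ (Δ[H] ≫ f ▷ H) ≫ (β_ H X).inv := by
      rw [h]
      simp
    _ = _ := by
      rw [hf]
      simp [← comp_whiskerRight]

lemma IsLeftIntegralOn.inv_antipode_comp [IsIso 𝒮[H]] {f : H ⟶ X} (hf : IsLeftIntegralOn f) :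
    IsRightIntegralOn (inv 𝒮[H] ≫ f) := by
  simp only [IsRightIntegralOn, IsLeftIntegralOn] at hf ⊢
  rw [← cancel_epi 𝒮[H]]
  calc
    _ = (Δ[H] ≫ H ◁ f) ≫ (β_ H X).hom ≫ X ◁ 𝒮[H] := by
      rw [reassoc_of% antipode_comul]
      simp [MonoidalCategory.tensorHom_def', ← comp_whiskerRight, ← whisker_exchange]
    _ = _ := by
      rw [hf]
      simp [← whiskerLeft_comp]

lemma IsLeftIntegralIn.comp_antipode [IsIso 𝒮[H]] {f : X ⟶ H} (hf : IsLeftIntegralIn f) :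
    IsRightIntegralIn (f ≫ 𝒮[H]) := by
  simp only [IsRightIntegralIn, IsLeftIntegralIn] at hf ⊢
  have h : H ◁ 𝒮[H] ≫ 𝒮[H] ▷ H ≫ μ[H] = (β_ H H).inv ≫ μ[H] ≫ 𝒮[H] := by
    rw [← cancel_epi (β_ H H).hom]
    simp [mul_antipode, MonoidalCategory.tensorHom_def]
  rw [← cancel_epi (X ◁ 𝒮[H])]
  calc
    _ = f ▷ H ≫ H ◁ 𝒮[H] ≫ 𝒮[H] ▷ H ≫ μ[H] := by simp [whisker_exchange_assoc]
    _ = (β_ H X).inv ≫ (H ◁ f ≫ μ[H]) ≫ 𝒮[H] := by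
      rw [h]
      simp
    _ = _ := by
      rw [hf, ← whiskerLeft_comp_assoc, antipode_counit]
      simp [← BraidedCategory.braiding_inv_naturality_right_assoc]

lemma IsRightIntegralIn.comp_inv_antipode [IsIso 𝒮[H]] {f : X ⟶ H} (hf : IsRightIntegralIn f) :
    IsLeftIntegralIn (f ≫ inv 𝒮[H]) := by
  simp only [IsRightIntegralIn, IsLeftIntegralIn] at hf ⊢
  rw [← cancel_mono 𝒮[H]]
  calc
    _ = H ◁ f ≫ H ◁ (inv 𝒮[H] ≫ 𝒮[H]) ≫ 𝒮[H] ▷ H ≫ (β_ H H).hom ≫ μ[H] := by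
      simp only [whiskerLeft_comp, Category.assoc, mul_antipode,
        MonoidalCategory.tensorHom_def']
    _ = 𝒮[H] ▷ X ≫ (β_ H X).hom ≫ f ▷ H ≫ μ[H] := by
      simp only [IsIso.inv_hom_id, whiskerLeft_id, Category.id_comp, whisker_exchange_assoc,
        BraidedCategory.braiding_naturality_right_assoc]
    _ = _ := by
      rw [hf, ← BraidedCategory.braiding_naturality_left_assoc, ← comp_whiskerRight_assoc,
        antipode_counit]
      simp

/-- Evaluate p(S(h)Λ₁) ⊗ p(Λ₂) with h and Λ both supplied by i.
`leftIntegral_antipode_rightIntegral` gives the braiding; right integrality of S ∘ i gives p(S(h)) ⊗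
p(Λ). -/
lemma cross_self_eq_of_integrals [IsIso 𝒮[H]] {I : C} {i : I ⟶ H} {p : H ⟶ I}
    (hi : IsLeftIntegralIn i) (hp : IsRightIntegralOn p) (hip : i ≫ p = 𝟙 I) (Z : C) :
    cross I I Z = (i ≫ 𝒮[H] ≫ p) ▷ (I ⊗ Z) := by
  have key := i ▷ _ ≫= leftIntegral_antipode_rightIntegral hi hp Z =≫ I ◁ p ▷ Z
  have hk := rightIntegral_join_mul hi.comp_antipode (H ⊗ Z)
  calc
    _ = i ▷ _ ≫ (cross H I Z ≫ (i ≫ p) ▷ (H ⊗ Z)) ≫ I ◁ p ▷ Z := by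
      rw [hip, id_whiskerRight, Category.comp_id, reassoc_of% @cross_nat_left, ← whiskerLeft_comp,
        ← comp_whiskerRight, hip, id_whiskerRight, whiskerLeft_id, Category.comp_id]
    _ = I ◁ i ▷ Z ≫ I ◁ split Δ[H] Z ≫ ((i ≫ 𝒮[H]) ▷ (H ⊗ H ⊗ Z) ≫ join μ[H] (H ⊗ Z)) ≫
          p ▷ (H ⊗ Z) ≫ I ◁ p ▷ Z := by
      rw [← key]
      simp only [comp_whiskerRight, Category.assoc, whisker_exchange_assoc]
    _ = I ◁ i ▷ Z ≫ (i ≫ 𝒮[H] ≫ p) ▷ (H ⊗ Z) ≫ I ◁ p ▷ Z := by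
      rw [hk, Category.assoc, ← whiskerLeft_comp_assoc I (split _ _), split_comul_del,
        whiskerLeft_id, Category.id_comp]
      simp only [comp_whiskerRight, Category.assoc]
    _ = _ := by
      rw [whisker_exchange_assoc, ← whiskerLeft_comp, ← comp_whiskerRight, hip, id_whiskerRight,
        whiskerLeft_id, Category.comp_id]

section Dual

variable [HasRightDual H]

variable (H) in
lemma isRightIntegralOn_intProj : IsRightIntegralOn (intProj H) := by
  rw [IsRightIntegralOn, ← whiskerRight_iff]
  have := comul_intProj H (𝟙_ C) =≫ (α_ H H (𝟙_ C)).inv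
  rw [ins] at this
  calc
    _ = (split Δ[H] (𝟙_ C) ≫ intProj H ▷ (H ⊗ 𝟙_ C)) ≫ (α_ H H (𝟙_ C)).inv := by
      simp only [split]
      monoidal
    _ = _ := by
      rw [this]
      monoidal

variable (H) in
lemma isLeftIntegralIn_intProj [IsIso 𝒮[H]] : IsLeftIntegralIn (intProj H) := by
  have h : H ◁ intProj H ▷ 𝟙_ C ≫ join μ[H] (𝟙_ C) =
      del ε[H] (H ⊗ 𝟙_ C) ≫ intProj H ▷ 𝟙_ C := by
    -- Invariance is known only under elements S(h); invertibility of S makes these all of H.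
    rw [← cancel_epi (𝒮[H] ▷ (H ⊗ 𝟙_ C)), antipode_intProj_join, reassoc_of% @antipode_del_counit]
  rw [IsLeftIntegralIn, ← whiskerRight_iff]
  calc
    _ = (α_ _ _ _).hom ≫ H ◁ intProj H ▷ 𝟙_ C ≫ join μ[H] (𝟙_ C) := by
      simp only [join]
      monoidal
    _ = _ := by
      rw [h]
      simp only [del]
      monoidal

/-- Cyclicity of the trace: the mates of i and p carry these maps around the loop, where they
combine to P. -/
lemma cup_integrals_cap [IsIso 𝒮[H]] {I : C} [HasRightDual I] {i : I ⟶ H} {p : H ⟶ I}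
    (hpi : p ≫ i = intProj H) (Z : C) :
    cup (η_ I Iᘁ) Z ≫ cross I Iᘁ Z ≫ Iᘁ ◁ (i ≫ 𝒮[H] ≫ p) ▷ Z ≫ cap (ε_ I Iᘁ) Z = 𝟙 Z := by
  rw [← cup_intProj_cross_antipode_cap H Z, ← hpi]
  simp only [comp_whiskerRight, whiskerLeft_comp, Category.assoc]
  rw [← rightAdjointMate_cap, ← reassoc_of% @cross_nat_left, whisker_exchange_assoc,
    ← reassoc_of% @cross_nat_right, ← whisker_exchange_assoc, reassoc_of% @cup_rightAdjointMate]

end Dual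

end Integrals

end BraidedIntegral

/-! ### Splitting the projection -/

theorem mainTheorem2 {C : Type*} [Category* C] [MonoidalCategory C] [BraidedCategory C]
    [RigidCategory C] [IsIdempotentComplete C]
    (H : C) [HopfObj H] (hS : IsIso (HopfObj.antipode (X := H))) :
    ∃ I : C, BraidedIntegral.IsInvertibleObj I ∧
      (∃ l : H ⟶ I, BraidedIntegral.IsLeftIntegralOn l ∧
        ∀ (X : C) (f : H ⟶ X), BraidedIntegral.IsLeftIntegralOn f → ∃! g : I ⟶ X, l ≫ g = f) ∧
      (∃ r : H ⟶ I, BraidedIntegral.IsRightIntegralOn r ∧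
        ∀ (X : C) (f : H ⟶ X), BraidedIntegral.IsRightIntegralOn f → ∃! g : I ⟶ X, r ≫ g = f) ∧
      (∃ l : I ⟶ H, BraidedIntegral.IsLeftIntegralIn l ∧
        ∀ (X : C) (f : X ⟶ H), BraidedIntegral.IsLeftIntegralIn f → ∃! h : X ⟶ I, h ≫ l = f) ∧
      (∃ r : I ⟶ H, BraidedIntegral.IsRightIntegralIn r ∧
        ∀ (X : C) (f : X ⟶ H), BraidedIntegral.IsRightIntegralIn f → ∃! h : X ⟶ I, h ≫ r = f) := by
  open BraidedIntegral in
  have hin := isLeftIntegralIn_intProj H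
  -- Idempotence is the fixing property for left integrals, applied to P itself.
  obtain ⟨I, i, p, hip, hpi⟩ := IsIdempotentComplete.idempotents_split H (intProj H)
    (leftIntegral_comp_intProj H hin)
  have hp : IsRightIntegralOn p := by
    have := (isRightIntegralOn_intProj H).comp p
    rwa [← hpi, Category.assoc, hip, Category.comp_id] at this
  have hi : IsLeftIntegralIn i := by
    have := hin.comp i
    rwa [← hpi, reassoc_of% hip] at this
  have factor_on {X : C} {f : H ⟶ X} (hf : IsRightIntegralOn f) : p ≫ i ≫ f = f := by
    rw [reassoc_of% hpi, intProj_comp_rightIntegral H hf]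
  have factor_in {X : C} {f : X ⟶ H} (hf : IsLeftIntegralIn f) : (f ≫ p) ≫ i = f := by
    rw [Category.assoc, hpi, leftIntegral_comp_intProj H hf]
  have : Epi p := epi_of_epi_fac hip
  have : Mono i := mono_of_mono_fac hip
  refine ⟨I, isInvertibleObj_of_cross _ (cross_self_eq_of_integrals hi hp hip)
      (cup_integrals_cap hpi _),
    ⟨HopfObj.antipode ≫ p, hp.antipode_comp, fun X f hf ↦ ⟨i ≫ inv HopfObj.antipode ≫ f, ?_, ?_⟩⟩,
    ⟨p, hp, fun X f hf ↦ ⟨i ≫ f, factor_on hf, ?_⟩⟩,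
    ⟨i, hi, fun X f hf ↦ ⟨f ≫ p, factor_in hf, ?_⟩⟩,
    ⟨i ≫ HopfObj.antipode, hi.comp_antipode,
      fun X f hf ↦ ⟨(f ≫ inv HopfObj.antipode) ≫ p, ?_, ?_⟩⟩⟩
  · simp [factor_on hf.inv_antipode_comp]
  · rintro g rfl
    simp [reassoc_of% hip]
  · rintro g rfl
    simp [reassoc_of% hip]
  · rintro g rfl
    simp [hip]
  · simp [reassoc_of% (factor_in hf.comp_inv_antipode)]
  · rintro g rfl
    simp [hip]
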